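/- Let $d \ge 0$ and $k \ge 1$ be integers. There is a constant $B_{d,k}$, depending only on $d$ and $k$, such that the following holds for every algebraically closed field $\mathbb F$ of characteristic zero and all integers $n, m \ge 0$. Let $P(n,d)$ be the space of homogeneous polynomials of degree $d$ in $n$ variables over $\mathbb F$, let $S = \{\ell^d : \ell \in P(n,1)\} \subseteq P(n,d)$ be the set of $d$-th powers of linear forms, and let $\mathrm{Ten}(m,k) = (\mathbb F^m)^{\otimes k}$. The tensor rank of $T \in \mathrm{Ten}(m,k)$ is the least $r$ such that $T$ is a sum of $r$ simple tensors $v_1 \otimes \cdots \otimes v_k$ with $v_i \in \mathbb F^m$, and the border rank $\mathrm{brk}(T)$ is the least $r$ such that $T$ lies in the Zariski closure of the set of tensors of tensor rank at most $r$. Let $\varphi : P(n,d) \to \mathrm{Ten}(m,k)$ be any linear map. Then $\max_{f \in P(n,d)} \mathrm{brk}(\varphi(f))$ exists, $\max_{s \in S} \mathrm{brk}(\varphi(s)) > 0$ unless $\varphi = 0$, and the border potency $$\mathrm{Bpot}(\varphi) = \frac{\max\{\mathrm{brk}(\varphi(f)) : f \in P(n,d)\}}{\max\{\mathrm{brk}(\varphi(s))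 : s \in S\}}$$ (read as $0$ for $\varphi = 0$) satisfies $$\mathrm{Bpot}(\varphi) \le B_{d,k} \cdot n^{\lfloor (k-1)d/k \rfloor},$$ with the convention $0^0 = 1$. -/

import Mathlib

noncomputable section

namespace BorderPotency

/-- The `S`-rank of `v`: the least `r` such that `v` is a sum of `r` elements of `S`. -/
def sRank {V : Type*} [AddCommMonoid V] (S : Set V) (v : V) : ℕ :=
  sInf {r : ℕ | ∃ s : Fin r → V, (∀ i, s i ∈ S) ∧ v = ∑ i, s i}

/-- `Ten(m,k)`, the `k`-fold tensor power of `F^m`. -/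
abbrev Ten (F : Type*) [Field F] (m k : ℕ) : Type _ :=
  PiTensorProduct F (fun _ : Fin k => Fin m → F)

/-- `P(n,d)`, the space of homogeneous polynomials of degree `d` in `n` variables. -/
abbrev Poly (F : Type*) [Field F] (n d : ℕ) : Submodule F (MvPolynomial (Fin n) F) :=
  MvPolynomial.homogeneousSubmodule (Fin n) F d

/-- The simple tensors `v₁ ⊗ ⋯ ⊗ v_k`. -/
def simpleTensors (F : Type*) [Field F] (m k : ℕ) : Set (Ten F m k) :=
  Set.range fun v : Fin k → Fin m → F => PiTensorProduct.tprod F v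

/-- The simples of `P(n,d)`: the `d`-th powers `ℓ ^ d` of linear forms `ℓ`. -/
def powersOfLinearForms (F : Type*) [Field F] (n d : ℕ) : Set (Poly F n d) :=
  {f | ∃ l ∈ Poly F n 1, (f : MvPolynomial (Fin n) F) = l ^ d}

/-- Tensor rank. -/
def tensorRank {F : Type*} [Field F] {m k : ℕ} (T : Ten F m k) : ℕ :=
  sRank (simpleTensors F m k) T

/-- The identification of `Ten(m,k)` with the affine space `F^(m^k)` given by the basis
`e_{i₁} ⊗ ⋯ ⊗ e_{i_k}`. -/
def coords (F : Type*) [Field F] (m k : ℕ) : Ten F m k ≃ₗ[F] ((Fin k → Fin m) → F) :=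
  (Basis.piTensorProduct fun _ : Fin k => Pi.basisFun F (Fin m)).equivFun

/-- The Zariski closure of a set of tensors: the common zeros of all polynomials in the
coordinates that vanish on the set. -/
def zariskiClosure {F : Type*} [Field F] {m k : ℕ} (A : Set (Ten F m k)) : Set (Ten F m k) :=
  coords F m k ⁻¹'
    MvPolynomial.zeroLocus F (MvPolynomial.vanishingIdeal F (coords F m k '' A))

/-- (Topological) border rank: the least `r` such that `T` lies in the Zariski closure of the
set of tensors of rank at most `r`. -/
def borderRank {F : Type*} [Field F] {m k : ℕ} (T : Ten F m k) : ℕ :=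
  sInf {r : ℕ | T ∈ zariskiClosure {T' : Ten F m k | tensorRank T' ≤ r}}

/-- The maximum of `brk(φ(f))` over `f ∈ A`. -/
def maxBorderRank {F : Type*} [Field F] {n d m k : ℕ} (φ : Poly F n d →ₗ[F] Ten F m k)
    (A : Set (Poly F n d)) : ℕ :=
  sSup ((fun f => borderRank (φ f)) '' A)

/-- The border potency of `φ : P(n,d) → Ten(m,k)`: the maximum of `brk(φ(f))` over all of
`P(n,d)`, divided by its maximum over the simples of `P(n,d)`. -/
def borderPotency {F : Type*} [Field F] {n d m k : ℕ} (φ : Poly F n d →ₗ[F] Ten F m k) : ℝ :=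
  (maxBorderRank φ Set.univ : ℝ) / (maxBorderRank φ (powersOfLinearForms F n d) : ℝ)

end BorderPotency

end

/-! Let r be the largest border rank of φ on d-th powers. Apply φ to the generic power (∑ tᵢxᵢ)^d:
this gives a tensor z with entries in F[t], and the differential operator f(∂/∂t)/d! turns z into
φ(f). If z were a sum of r simple tensors, each Leibniz term would spread d derivatives over k
factors. Some factor receives at least d/k of them, and the sum over the corresponding indices can
be carried out inside that factor. At most ⌊(k-1)d/k⌋ indices stay free, so the rank is at most r ·
k^d · n^⌊(k-1)d/k⌋ (`exists_decomposition_sum_iterOp`).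

For border rank, z is only in the closure of the rank-r tensors, and closures do not obviously
respect differentiation. Let K be the algebraic closure of F(t). Curve selection
(`exists_arc_of_mem_closure_image`) gives an arc Z over K⟦X⟧ with constant term z that has rank at
most r over an algebraic closure L of the fraction field of K⟦X⟧. In characteristic zero the
derivations ∂/∂tᵢ extend through F[t] → K → K⟦X⟧ → L, acting coefficientwise on power series, hence
compatibly with taking constant terms. So f(∂)/d! applied to Z has bounded rank over L and constant
term φ(f). Every polynomial over F vanishing on tensors of that rank therefore vanishes at φ(f)
(`borderRank_le`). -/

namespace BorderPotency

/-! ### Leibniz expansion and the rank of differentiated tensors -/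

/-- The composition of those operators `D (w 0), D (w 1), …` whose position is selected by `s`. -/
def iterOp {R : Type*} {n : ℕ} (D : Fin n → R → R) :
    (d : ℕ) → (Fin d → Fin n) → (Fin d → Bool) → R → R
  | 0, _, _, x => x
  | d + 1, w, s, x =>
    if s 0 then D (w 0) (iterOp D d (Fin.tail w) (Fin.tail s) x)
    else iterOp D d (Fin.tail w) (Fin.tail s) x

theorem iterOp_congr {R : Type*} {n : ℕ} (D : Fin n → R → R) (d : ℕ) (w w' : Fin d → Fin n)
    (s : Fin d → Bool) (h : ∀ j, s j = true → w j = w' j) (x : R) :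
    iterOp D d w s x = iterOp D d w' s x := by
  induction d with
  | zero => rfl
  | succ d ih =>
    have := ih (Fin.tail w) (Fin.tail w') (Fin.tail s) fun j hj => h j.succ hj
    simp only [iterOp, this]
    split_ifs with h0
    · rw [h 0 h0]
    · rfl

theorem map_iterOp {R S : Type*} {n : ℕ} {D : Fin n → R → R} {D' : Fin n → S → S} (f : R → S)
    (hf : ∀ i x, f (D i x) = D' i (f x)) (d : ℕ) (w : Fin d → Fin n) (s : Fin d → Bool) (x : R) :
    f (iterOp D d w s x) = iterOp D' d w s (f x) := by
  induction d with
  | zero => rfl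
  | succ d ih =>
    simp only [iterOp]
    split_ifs
    · rw [hf, ih]
    · rw [ih]

section Leibniz

variable {B R : Type*} [CommRing B] [CommRing R] [Algebra B R] {n : ℕ}
  (D : Fin n → Derivation B R R)

theorem iterOp_sum {J : Type*} (t : Finset J) (d : ℕ) (w : Fin d → Fin n) (s : Fin d → Bool)
    (x : J → R) :
    iterOp (fun i => D i) d w s (∑ j ∈ t, x j) = ∑ j ∈ t, iterOp (fun i => D i) d w s (x j) := by
  induction d with
  | zero => rfl
  | succ d ih =>
    simp only [iterOp]
    split_ifs
    · rw [ih, map_sum]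
    · rw [ih]

theorem derivation_prod {k : ℕ} (δ : Derivation B R R) (x : Fin k → R) :
    δ (∏ a, x a) = ∑ b, ∏ a, if b = a then δ (x a) else x a := by
  induction k with
  | zero => simp
  | succ k ih =>
    rw [Fin.prod_univ_succ, Derivation.leibniz, ih, Fin.sum_univ_succ]
    simp only [Fin.prod_univ_succ, smul_eq_mul]
    simp [Finset.mul_sum, Fin.succ_ne_zero, (Fin.succ_ne_zero _).symm, mul_comm, add_comm]

/-- The Leibniz rule for a composition of derivations. -/
theorem iterOp_prod {k : ℕ} (d : ℕ) (w : Fin d → Fin n) (x : Fin k → R) :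
    iterOp (fun i => D i) d w (fun _ => true) (∏ a, x a) =
      ∑ χ : Fin d → Fin k, ∏ a, iterOp (fun i => D i) d w (fun j => decide (χ j = a)) (x a) := by
  induction d with
  | zero => simp [iterOp]
  | succ d ih =>
    have h1 : iterOp (fun i => D i) (d + 1) w (fun _ => true) (∏ a, x a) =
        D (w 0) (iterOp (fun i => D i) d (Fin.tail w) (fun _ => true) (∏ a, x a)) := rfl
    rw [h1, ih, map_sum, ← (Fin.consEquiv fun _ => Fin k).sum_comp, Fintype.sum_prod_type,
      Finset.sum_comm]
    refine Finset.sum_congr rfl fun χ _ => ?_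
    rw [derivation_prod]
    refine Finset.sum_congr rfl fun b _ => Finset.prod_congr rfl fun a _ => ?_
    have h2 : (Fin.tail fun j => decide ((Fin.consEquiv fun _ => Fin k) (b, χ) j = a)) =
        fun j => decide (χ j = a) := by
      ext j; simp [Fin.tail, Fin.consEquiv]
    simp only [iterOp, h2]
    simp [Fin.consEquiv]

/-- Pigeonhole: a largest fibre has at least d/k elements. This is the source of the exponent in the
theorem. -/
theorem exists_large_fiber {k d : ℕ} (hk : 1 ≤ k) (χ : Fin d → Fin k) :
    ∃ a, Fintype.card {j // ¬ χ j = a} ≤ (k - 1) * d / k := by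
  have : Nonempty (Fin k) := ⟨⟨0, hk⟩⟩
  obtain ⟨a, ha⟩ : ∃ a, d ≤ k * Fintype.card {j // χ j = a} := by
    by_contra! h
    have h1 : ∑ a : Fin k, Fintype.card {j // χ j = a} = d := by
      rw [← Fintype.card_sigma, Fintype.card_congr (Equiv.sigmaFiberEquiv χ), Fintype.card_fin]
    have h2 : ∑ a : Fin k, k * Fintype.card {j // χ j = a} < ∑ a : Fin k, d :=
      Finset.sum_lt_sum_of_nonempty Finset.univ_nonempty fun a _ => h a
    rw [← Finset.mul_sum, h1] at h2
    simp at h2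
  refine ⟨a, ?_⟩
  have h3 := Fintype.card_subtype_compl (fun j => χ j = a)
  have h4 := Fintype.card_subtype_le (fun j => χ j = a)
  rw [Fintype.card_fin] at h3 h4
  rw [Nat.le_div_iff_mul_le (by omega), h3, Nat.sub_mul, Nat.sub_mul, mul_comm d k, one_mul,
    mul_comm _ k]
  omega

/-- A combination of derivatives of order `d` of a tensor of rank `r` has rank at most
`r * k ^ d * n ^ ((k - 1) * d / k)`: in each term of the Leibniz expansion, the sum over the
derivatives which hit the most differentiated factor is absorbed in that factor. -/
theorem exists_decomposition_sum_iterOp {k m d r : ℕ} (hk : 1 ≤ k) (hn : d = 0 ∨ 1 ≤ n)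
    (c : (Fin d → Fin n) → R) (v : Fin r → Fin k → Fin m → R) :
    ∃ (J : Type) (_ : Fintype J) (u : J → Fin k → Fin m → R),
      Fintype.card J ≤ r * k ^ d * n ^ ((k - 1) * d / k) ∧
      ∀ p : Fin k → Fin m,
        ∑ w, c w * iterOp (fun i => D i) d w (fun _ => true) (∑ j, ∏ a, v j a (p a)) =
          ∑ x, ∏ a, u x a (p a) := by
  classical
  choose A hA using fun χ : Fin d → Fin k => exists_large_fiber hk χ
  let e (χ : Fin d → Fin k) := Equiv.piEquivPiSubtypeProd (fun j => χ j = A χ) fun _ => Fin n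
  -- Filler letters for the positions in the large fibre. The factors other than `A χ` never read
  -- them; their existence needs n ≥ 1 or d = 0.
  let i0 : Fin d → Fin n := fun j => ⟨0, hn.resolve_left fun h => (h ▸ j).elim0⟩
  let J := Σ (_ : Fin r) (χ : Fin d → Fin k), ({j // ¬ χ j = A χ} → Fin n)
  let ext (χ : Fin d → Fin k) (y : {j // ¬ χ j = A χ} → Fin n) : Fin d → Fin n :=
    (e χ).symm (fun j => i0 j, y)
  -- The factor `A χ` absorbs both the coefficient `c` and the sum over its own letters `y'`; this
  -- is legitimate because no other factor depends on `y'`.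
  let u : J → Fin k → Fin m → R := fun x a i =>
    if a = A x.2.1 then
      ∑ y' : {j // x.2.1 j = A x.2.1} → Fin n, c ((e x.2.1).symm (y', x.2.2)) *
        iterOp (fun i => D i) d ((e x.2.1).symm (y', x.2.2)) (fun j => decide (x.2.1 j = a))
          (v x.1 a i)
    else
      iterOp (fun i => D i) d (ext x.2.1 x.2.2) (fun j => decide (x.2.1 j = a)) (v x.1 a i)
  refine ⟨J, inferInstance, u, ?_, fun p => ?_⟩
  · simp only [J, Fintype.card_sigma, Fintype.card_fun, Fintype.card_fin]
    rw [Finset.sum_const, Finset.card_univ, Fintype.card_fin, smul_eq_mul, mul_assoc]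
    refine Nat.mul_le_mul_left _ ?_
    refine (Finset.sum_le_card_nsmul _ _ (n ^ ((k - 1) * d / k)) fun χ _ =>
      ?_).trans (by simp)
    rcases hn with rfl | hn
    · simp
    · exact Nat.pow_le_pow_right hn (hA χ)
  · simp only [iterOp_sum, iterOp_prod, Finset.mul_sum]
    rw [Finset.sum_comm]
    simp only [J, Fintype.sum_sigma]
    refine Finset.sum_congr rfl fun j _ => ?_
    rw [Finset.sum_comm]
    refine Finset.sum_congr rfl fun χ _ => ?_
    rw [← (e χ).symm.sum_comp, Fintype.sum_prod_type, Finset.sum_comm]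
    refine Finset.sum_congr rfl fun y _ => ?_
    rw [← Finset.mul_prod_erase Finset.univ _ (Finset.mem_univ (A χ))]
    simp only [u, if_true]
    rw [Finset.sum_mul]
    refine Finset.sum_congr rfl fun y' _ => ?_
    rw [← Finset.mul_prod_erase Finset.univ _ (Finset.mem_univ (A χ)), mul_assoc]
    congr 2
    refine Finset.prod_congr rfl fun a ha => ?_
    rw [if_neg (Finset.ne_of_mem_erase ha)]
    refine iterOp_congr _ _ _ _ _ (fun l hl => ?_) _
    have : ¬ χ l = A χ := by
      have h1 : χ l = a := by simpa using hl
      rw [h1]; exact Finset.ne_of_mem_erase ha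
    simp [ext, e, Equiv.piEquivPiSubtypeProd, this]

end Leibniz

/-! ### Powers of the generic linear form and their derivatives -/

section GenericPower

open MvPolynomial

variable {F : Type*} [Field F] {n : ℕ}

/-- The polynomial `t ↦ l ((∑ i, t i * x i) ^ j * g)`. -/
noncomputable def genericPower (l : MvPolynomial (Fin n) F →ₗ[F] F) :
    ℕ → MvPolynomial (Fin n) F → MvPolynomial (Fin n) F
  | 0, g => C (l g)
  | j + 1, g => ∑ i, X i * genericPower l j (X i * g)

theorem eval_genericPower (l : MvPolynomial (Fin n) F →ₗ[F] F) (j : ℕ)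
    (g : MvPolynomial (Fin n) F) (a : Fin n → F) :
    eval a (genericPower l j g) = l ((∑ i, C (a i) * X i) ^ j * g) := by
  induction j generalizing g with
  | zero => simp [genericPower]
  | succ j ih =>
    simp only [genericPower, map_sum, map_mul, eval_X, ih]
    rw [pow_succ, mul_assoc, Finset.sum_mul, Finset.mul_sum, map_sum]
    refine Finset.sum_congr rfl fun i _ => ?_
    rw [← smul_eq_mul, ← map_smul, MvPolynomial.smul_eq_C_mul]
    congr 1
    ring

theorem pderiv_genericPower (l : MvPolynomial (Fin n) F →ₗ[F] F) (i : Fin n) (j : ℕ)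
    (g : MvPolynomial (Fin n) F) :
    pderiv i (genericPower l j g) = (j : MvPolynomial (Fin n) F) *
      genericPower l (j - 1) (X i * g) := by
  induction j generalizing g with
  | zero => simp [genericPower]
  | succ j ih =>
    simp only [genericPower, map_sum, Derivation.leibniz, ih, pderiv_X, smul_eq_mul,
      Finset.sum_add_distrib, Nat.add_sub_cancel]
    have h : ∑ x, genericPower l j (X x * g) * Pi.single (M := fun _ => MvPolynomial (Fin n) F) i 1 x =
        genericPower l j (X i * g) := by
      rw [Finset.sum_eq_single i] <;> simp +contextual
    rcases j with _ | j
    · simpa using h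
    · rw [h]
      have h' : ∀ x : Fin n, (X x : MvPolynomial (Fin n) F) * (((j + 1 : ℕ) : MvPolynomial (Fin n) F) *
          genericPower l (j + 1 - 1) (X i * (X x * g))) = ((j + 1 : ℕ) : MvPolynomial (Fin n) F) *
          (X x * genericPower l j (X x * (X i * g))) := fun x => by
        rw [Nat.add_sub_cancel, mul_left_comm (X i) (X x) g]; ring
      simp only [h', ← Finset.mul_sum]
      rw [← genericPower]
      push_cast
      ring

/-- With e = 0 and g = 1 this recovers d! times the value of `l` on an arbitrary monomial from the
generic d-th power. General e and g are needed for the induction. -/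
theorem iterOp_pderiv_genericPower (l : MvPolynomial (Fin n) F →ₗ[F] F) (d e : ℕ)
    (w : Fin d → Fin n) (g : MvPolynomial (Fin n) F) :
    iterOp (fun i => pderiv i) d w (fun _ => true) (genericPower l (e + d) g) =
      ((e + d).descFactorial d : MvPolynomial (Fin n) F) * genericPower l e ((∏ j, X (w j)) * g) := by
  induction d generalizing e g with
  | zero => simp [iterOp]
  | succ d ih =>
    have h1 : iterOp (fun i => pderiv i) (d + 1) w (fun _ => true) (genericPower l (e + (d + 1)) g) =
        pderiv (w 0) (iterOp (fun i => pderiv i) d (Fin.tail w) (fun _ => true)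
          (genericPower l (e + (d + 1)) g)) := rfl
    rw [h1, show e + (d + 1) = (e + 1) + d by ring, ih (e + 1), Derivation.leibniz,
      Derivation.map_natCast, smul_zero, add_zero, pderiv_genericPower, Nat.add_sub_cancel,
      Fin.prod_univ_succ, smul_eq_mul, ← mul_assoc, ← mul_assoc]
    congr 1
    rw [Nat.descFactorial_succ]
    rw [show e + 1 + d - d = e + 1 by omega]
    push_cast
    ring

end GenericPower

/-! ### Extending derivations -/

section Derivation

/-- For formally étale R → S the differentials of S are the base change of those of R, so the
S-linear map attached to `D` lifts. -/
theorem exists_derivation_extends {B : Type*} (R S : Type*) [CommRing B] [CommRing R]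
    [CommRing S] [Algebra B R] [Algebra B S] [Algebra R S] [IsScalarTower B R S]
    [Algebra.FormallyEtale R S] (D : Derivation B R R) :
    ∃ D' : Derivation B S S, ∀ x, D' (algebraMap R S x) = algebraMap R S (D x) := by
  let D₁ : Derivation B R S := (Algebra.linearMap R S).compDer D
  let f := (KaehlerDifferential.isBaseChange_of_formallyEtale B R S).lift
    D₁.liftKaehlerDifferential
  refine ⟨f.compDer (KaehlerDifferential.D B S), fun x => ?_⟩
  have h := (KaehlerDifferential.isBaseChange_of_formallyEtale B R S).lift_eq
    D₁.liftKaehlerDifferential (KaehlerDifferential.D B R x)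
  rw [KaehlerDifferential.map_D, Derivation.liftKaehlerDifferential_comp_D] at h
  exact h

instance formallyEtale_algebraicClosure_fractionRing (R : Type*) [CommRing R] [IsDomain R]
    [CharZero R] : Algebra.FormallyEtale R (AlgebraicClosure (FractionRing R)) := by
  have : Algebra.FormallyEtale R (FractionRing R) :=
    Algebra.FormallyEtale.of_isLocalization (nonZeroDivisors R)
  have : CharZero (FractionRing R) :=
    charZero_of_injective_algebraMap (IsFractionRing.injective R (FractionRing R))
  have : Algebra.FormallyEtale (FractionRing R) (AlgebraicClosure (FractionRing R)) :=
    Algebra.FormallyEtale.of_isSeparable _ _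
  exact Algebra.FormallyEtale.comp R (FractionRing R) _

-- The extension acts coefficientwise, thus treats the variable X as a constant; this is why it
-- commutes with specialisation at X = 0.
open PowerSeries in
theorem exists_derivation_powerSeries {B R : Type*} [CommRing B] [CommRing R] [Algebra B R]
    (D : Derivation B R R) :
    ∃ D' : Derivation B R⟦X⟧ R⟦X⟧, ∀ f, constantCoeff (D' f) = D (constantCoeff f) := by
  let g : R⟦X⟧ → R⟦X⟧ := fun f => PowerSeries.mk fun n => D (coeff n f)
  have hg : ∀ n f, coeff n (g f) = D (coeff n f) := fun n f => coeff_mk _ _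
  have hmul : ∀ a b, g (a * b) = a * g b + b * g a := fun a b => by
    ext n
    rw [hg, map_add, coeff_mul, coeff_mul, coeff_mul, map_sum,
      ← Finset.Nat.sum_antidiagonal_swap (f := fun p => coeff p.1 b * coeff p.2 (g a)),
      ← Finset.sum_add_distrib]
    refine Finset.sum_congr rfl fun p _ => ?_
    rw [Derivation.leibniz, smul_eq_mul, smul_eq_mul, hg, Prod.fst_swap, Prod.snd_swap, hg]
  let g' : R⟦X⟧ →ₗ[B] R⟦X⟧ :=
    { toFun := g
      map_add' := fun a b => by ext n; rw [hg, map_add, map_add, map_add, hg, hg]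
      map_smul' := fun c f => by
        ext n
        rw [hg, RingHom.id_apply, Algebra.smul_def, Algebra.smul_def, PowerSeries.algebraMap_apply,
          coeff_C_mul, coeff_C_mul, hg, ← Algebra.smul_def, ← Algebra.smul_def, Derivation.map_smul] }
  refine ⟨Derivation.mk' g' hmul, fun f => ?_⟩
  · have := hg 0 f
    rwa [coeff_zero_eq_constantCoeff_apply, coeff_zero_eq_constantCoeff_apply] at this

end Derivation

/-! ### Formal branches of curves -/

section Arc

open PowerSeries in
/-- The expansion in powers of `p`, where `p` generates the kernel of `ε`. -/
theorem exists_powerSeries_expansion {K O : Type*} [Field K] [CommRing O] [IsDomain O]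
    [Algebra K O] (p : O) (hp : p ≠ 0) (ε : O →ₐ[K] K) (hε : ∀ x, ε x = 0 ↔ p ∣ x)
    (hsep : ∀ x, (∀ n : ℕ, p ^ n ∣ x) → x = 0) :
    ∃ γ : O →ₐ[K] K⟦X⟧, Function.Injective γ ∧ ∀ x, constantCoeff (γ x) = ε x := by
  -- The quotient y =: s(x) is the tail of the expansion x = ε(x) + p·s(x); iterating s yields the
  -- successive coefficients.
  have h : ∀ x, ∃ y, x - algebraMap K O (ε x) = p * y := fun x => by
    have : p ∣ x - algebraMap K O (ε x) := by rw [← hε]; simp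
    exact this
  choose s hs using h
  have hs' : ∀ x, x = algebraMap K O (ε x) + p * s x := fun x => by rw [← hs]; ring
  have hs_add : ∀ x y, s (x + y) = s x + s y := fun x y => by
    apply mul_left_cancel₀ hp
    rw [mul_add, ← hs, ← hs, ← hs, map_add, map_add]; ring
  have hs_mul : ∀ x y, s (x * y) = algebraMap K O (ε x) * s y + s x * y := fun x y => by
    apply mul_left_cancel₀ hp
    rw [← hs, map_mul, map_mul, mul_add, mul_left_comm, ← mul_assoc p, ← hs, ← hs]; ring
  have hs_alg : ∀ a, s (algebraMap K O a) = 0 := fun a => by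
    apply mul_left_cancel₀ hp
    rw [← hs]; simp
  let γ : O → K⟦X⟧ := fun x => PowerSeries.mk fun n => ε (s^[n] x)
  have h0 : ∀ x, coeff 0 (γ x) = ε x := fun x => by simp [γ]
  have h1 : ∀ n x, coeff (n + 1) (γ x) = coeff n (γ (s x)) := fun n x => by simp [γ]
  have hγ : ∀ x, γ x = C (ε x) + X * γ (s x) := fun x => by
    ext n
    rcases n with _ | n
    · simp [h0]
    · simp [h1, coeff_succ_X_mul]
  have hadd : ∀ n x y, coeff n (γ (x + y)) = coeff n (γ x) + coeff n (γ y) := fun n => by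
    induction n with
    | zero => intro x y; simp only [h0, map_add]
    | succ n ih => intro x y; simp only [h1, hs_add, ih]
  have halg : ∀ a, γ (algebraMap K O a) = C a := fun a => by
    have hz : γ 0 = 0 := by
      ext n
      have := hadd n 0 0
      simpa using this
    rw [hγ, hs_alg, hz]; simp
  have hscal : ∀ n a x, coeff n (γ (algebraMap K O a * x)) = a * coeff n (γ x) := fun n => by
    induction n with
    | zero => intro a x; simp only [h0, map_mul]; simp
    | succ n ih =>
      intro a x
      rw [h1, h1, hs_mul, hs_alg, zero_mul, add_zero, AlgHom.commutes, ih]; rfl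
  have hmul : ∀ n x y, coeff n (γ (x * y)) = coeff n (γ x * γ y) := fun n => by
    induction n with
    | zero => intro x y; simp [h0, coeff_mul]
    | succ n ih =>
      intro x y
      rw [h1, hs_mul, hadd, hscal, ih, hγ x, add_mul, map_add, coeff_C_mul, h1, mul_assoc,
        coeff_succ_X_mul]
  let Γ : O →ₐ[K] K⟦X⟧ :=
    { toFun := γ
      map_one' := by rw [← map_one (algebraMap K O), halg, map_one]
      map_zero' := by rw [← map_zero (algebraMap K O), halg, map_zero]
      map_add' := fun x y => by ext n; rw [hadd, map_add]
      map_mul' := fun x y => by ext n; rw [hmul]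
      commutes' := halg }
  refine ⟨Γ, ?_, fun x => by rw [← coeff_zero_eq_constantCoeff_apply]; exact h0 x⟩
  rw [injective_iff_map_eq_zero]
  intro x hx
  -- An element with zero expansion is divisible by every power of p, so `hsep` gives injectivity.
  have key : ∀ (n : ℕ) x, γ x = 0 → p ^ n ∣ x := fun n => by
    induction n with
    | zero => intro x _; simp
    | succ n ih =>
      intro x hx
      have e0 : ε x = 0 := by rw [← h0, hx]; simp
      have e1 : γ (s x) = 0 := by ext n; rw [← h1, hx]; simp
      rw [hs' x, e0, map_zero, zero_add, pow_succ']
      exact mul_dvd_mul_left p (ih _ e1)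
  exact hsep x fun n => key n x hx

end Arc

section Arc

open scoped PowerSeries Polynomial

-- Localising at the kernel of ε gives a discrete valuation ring with residue field K; expand in
-- powers of a uniformiser.
open PowerSeries in
theorem exists_powerSeries_expansion_dedekind {K O : Type*} [Field K] [CommRing O]
    [IsDedekindDomain O] [Algebra K O] (ε : O →ₐ[K] K) (hε : RingHom.ker ε ≠ ⊥) :
    ∃ γ : O →ₐ[K] K⟦X⟧, Function.Injective γ ∧ ∀ x, constantCoeff (γ x) = ε x := by
  let M := RingHom.ker ε
  have hM : M.IsPrime := RingHom.ker_isPrime ε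
  let OM := Localization.AtPrime M
  have hdvr : IsDiscreteValuationRing OM :=
    IsLocalization.AtPrime.isDiscreteValuationRing_of_dedekind_domain O hε OM
  let ε' : OM →ₐ[K] K := IsLocalization.liftAlgHom (M := M.primeCompl) (f := ε) fun y =>
    isUnit_iff_ne_zero.mpr y.2
  have hε' : ∀ x, ε' (algebraMap O OM x) = ε x := fun x => IsLocalization.lift_eq _ x
  have hker : RingHom.ker ε' = IsLocalRing.maximalIdeal OM := by
    have := RingHom.ker_isMaximal_of_surjective ε' fun a => ⟨algebraMap K OM a, by simp⟩
    exact IsLocalRing.eq_maximalIdeal this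
  obtain ⟨p, hp⟩ := IsDiscreteValuationRing.exists_irreducible OM
  obtain ⟨γ, hγ, hγ'⟩ := exists_powerSeries_expansion p hp.ne_zero ε'
    (fun x => by rw [← RingHom.mem_ker, hker, hp.maximalIdeal_eq, Ideal.mem_span_singleton])
    (fun x hx => by
      by_contra h0
      obtain ⟨n, hn⟩ := FiniteMultiplicity.of_not_isUnit hp.not_isUnit h0
      exact hn (hx _))
  refine ⟨γ.comp (IsScalarTower.toAlgHom K O OM), ?_, fun x => ?_⟩
  · exact hγ.comp (IsLocalization.injective OM M.primeCompl_le_nonZeroDivisors)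
  · exact (hγ' _).trans (hε' x)

open PowerSeries in
/-- A point of an affine curve is the centre of a formal branch that is generic on the curve. -/
theorem exists_branch {K D : Type*} [Field K] [IsAlgClosed K] [CharZero K] [CommRing D]
    [IsDomain D] [Algebra K D] (τ : K[X] →ₐ[K] D) (hτ : Function.Injective τ) (hfin : τ.Finite)
    (ζ : D →ₐ[K] K) :
    ∃ γ : D →ₐ[K] K⟦X⟧, Function.Injective γ ∧ ∀ x, constantCoeff (γ x) = ζ x := by
  let : Algebra K[X] D := τ.toRingHom.toAlgebra
  have : IsScalarTower K K[X] D := IsScalarTower.of_algebraMap_eq fun a => (τ.commutes a).symm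
  have : Module.Finite K[X] D := hfin
  have hinj : Function.Injective (algebraMap K[X] D) := hτ
  have : FaithfulSMul K[X] D := (faithfulSMul_iff_algebraMap_injective _ _).mpr hinj
  have hinj' : Function.Injective (algebraMap K[X] (FractionRing D)) := by
    rw [IsScalarTower.algebraMap_eq K[X] D (FractionRing D)]
    exact (IsFractionRing.injective D (FractionRing D)).comp hinj
  have : FaithfulSMul K[X] (FractionRing D) := (faithfulSMul_iff_algebraMap_injective _ _).mpr hinj'
  have : IsScalarTower K K[X] (FractionRing D) := IsScalarTower.of_algebraMap_eq fun a => by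
    rw [IsScalarTower.algebraMap_apply K[X] D, ← IsScalarTower.algebraMap_apply K K[X] D,
      ← IsScalarTower.algebraMap_apply K D]
  let : Algebra (FractionRing K[X]) (FractionRing D) := FractionRing.liftAlgebra _ _
  have : CharZero (FractionRing K[X]) :=
    charZero_of_injective_algebraMap (IsFractionRing.injective K[X] (FractionRing K[X]))
  have : FiniteDimensional (FractionRing K[X]) (FractionRing D) :=
    Module.Finite.of_isLocalization K[X] D (nonZeroDivisors K[X])
  -- The normalisation of the curve. The given point lifts to it by lying over, and there the local
  -- ring is a discrete valuation ring.
  let O := integralClosure K[X] (FractionRing D)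
  have : IsDedekindDomain O := integralClosure.isDedekindDomain_fractionRing _ _
  let j : D →ₐ[K[X]] O := IsIntegralClosure.lift K[X] O (FractionRing D)
  let : Algebra D O := j.toRingHom.toAlgebra
  have hj : ∀ x, algebraMap D O x = j x := fun x => rfl
  have : IsScalarTower K[X] D O := IsScalarTower.of_algebraMap_eq fun a => (j.commutes a).symm
  have hOint : Algebra.IsIntegral K[X] O := inferInstance
  have : Algebra.IsIntegral D O := Algebra.IsIntegral.tower_top K[X]
  have hjinj : Function.Injective j := by
    have h : ∀ x, algebraMap O (FractionRing D) (j x) = algebraMap D (FractionRing D) x := fun x =>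
      IsIntegralClosure.algebraMap_lift K[X] O (FractionRing D) x
    intro x y hxy
    apply IsFractionRing.injective D (FractionRing D)
    rw [← h, ← h, hxy]
  have hζ : (RingHom.ker ζ).IsPrime := RingHom.ker_isPrime ζ
  obtain ⟨M, -, hM, hMover⟩ := Ideal.exists_ideal_over_prime_of_isIntegral (RingHom.ker ζ) (⊥ : Ideal O)
    (by
      intro x hx
      have : j x = 0 := hx
      rw [map_eq_zero_iff j hjinj] at this
      simp [this])
  have hjM : ∀ x, j x ∈ M ↔ ζ x = 0 := fun x => by
    rw [← RingHom.mem_ker, ← hMover]; rfl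
  have hKj : ∀ a, j (algebraMap K D a) = algebraMap K O a := fun a => by
    rw [IsScalarTower.algebraMap_apply K K[X] D, AlgHom.commutes,
      ← IsScalarTower.algebraMap_apply K K[X] O]
  -- K[X] acts on O/M through evaluation at the point, so O/M is integral over the algebraically
  -- closed field K.
  have hbij : Function.Bijective (algebraMap K (O ⧸ M)) := by
    have : Algebra.IsIntegral K (O ⧸ M) := by
      constructor
      have h1 : (algebraMap K[X] (O ⧸ M)).IsIntegral :=
        (algebraMap_isIntegral_iff (R := K[X]) (A := O ⧸ M)).mpr inferInstance
      have h2 : algebraMap K[X] (O ⧸ M) = (algebraMap K (O ⧸ M)).comp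
          (Polynomial.evalRingHom (ζ (algebraMap K[X] D Polynomial.X))) := by
        ext a
        · simp only [RingHom.comp_apply, Polynomial.coe_evalRingHom, Polynomial.eval_C]
          exact (IsScalarTower.algebraMap_apply K K[X] (O ⧸ M) a).symm
        · simp only [RingHom.comp_apply, Polynomial.coe_evalRingHom, Polynomial.eval_X]
          rw [← sub_eq_zero, IsScalarTower.algebraMap_apply K[X] O (O ⧸ M),
            IsScalarTower.algebraMap_apply K O (O ⧸ M), ← map_sub, Ideal.Quotient.algebraMap_eq,
            Ideal.Quotient.eq_zero_iff_mem, ← hKj, ← j.commutes, ← map_sub, hjM]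
          simp
      rw [h2] at h1
      exact h1.tower_top _ _
    exact IsAlgClosed.algebraMap_bijective_of_isIntegral
  let e : K ≃ₐ[K] (O ⧸ M) := AlgEquiv.ofBijective (Algebra.ofId K (O ⧸ M)) hbij
  let ε : O →ₐ[K] K := e.symm.toAlgHom.comp (Ideal.Quotient.mkₐ K M)
  have hε : ∀ x, ε x = 0 ↔ x ∈ M := fun x => by
    simp [ε, Ideal.Quotient.eq_zero_iff_mem]
  have hεj : ∀ x, ε (j x) = ζ x := fun x => by
    have h : j (x - algebraMap K D (ζ x)) ∈ M := by rw [hjM]; simp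
    rw [← hε, map_sub, hKj, map_sub, AlgHom.commutes, sub_eq_zero] at h
    exact h
  obtain ⟨γ, hγ, hγ'⟩ := exists_powerSeries_expansion_dedekind ε (by
    intro h
    have h1 : j (algebraMap K[X] D (Polynomial.X -
        Polynomial.C (ζ (algebraMap K[X] D Polynomial.X)))) ∈ RingHom.ker ε := by
      rw [RingHom.mem_ker, hεj, map_sub, map_sub, sub_eq_zero]
      have : algebraMap K[X] D (Polynomial.C (ζ (algebraMap K[X] D Polynomial.X))) =
          algebraMap K D (ζ (algebraMap K[X] D Polynomial.X)) :=
        (IsScalarTower.algebraMap_apply K K[X] D _).symm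
      rw [this, AlgHom.commutes]; rfl
    rw [h, Ideal.mem_bot, map_eq_zero_iff j hjinj, map_eq_zero_iff _ hinj] at h1
    exact Polynomial.X_sub_C_ne_zero _ h1)
  refine ⟨γ.comp (j.restrictScalars K), hγ.comp hjinj, fun x => ?_⟩
  exact (hγ' _).trans (hεj x)

end Arc

/-! ### Arcs on varieties and curve selection -/

section Arc

open scoped PowerSeries Polynomial TensorProduct

universe u

open PowerSeries in
/-- A point of an irreducible affine variety is the centre of an arc that meets a prescribed
nonempty open set. -/
theorem exists_arc {K C : Type*} [Field K] [IsAlgClosed K] [CharZero K] [CommRing C] [IsDomain C]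
    [Algebra K C] [Algebra.FiniteType K C] (ζ : C →ₐ[K] K) (h : C) (hh : h ≠ 0) :
    ∃ γ : C →ₐ[K] K⟦X⟧, γ h ≠ 0 ∧ ∀ x, constantCoeff (γ x) = ζ x := by
  -- If h does not vanish at the point, the constant arc suffices.
  by_cases hζ : ζ h = 0
  swap
  · refine ⟨(Algebra.ofId K K⟦X⟧).comp ζ, fun h0 => hζ ?_, fun x => ?_⟩
    · have := congrArg constantCoeff h0
      simpa [Algebra.ofId_apply, PowerSeries.algebraMap_apply] using this
    · simp [Algebra.ofId_apply]
  obtain ⟨s, g, hg, hgfin⟩ := exists_finite_inj_algHom_of_fg K C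
  let : Algebra (MvPolynomial (Fin s) K) C := g.toRingHom.toAlgebra
  have hfin : Module.Finite (MvPolynomial (Fin s) K) C := hgfin
  have : FaithfulSMul (MvPolynomial (Fin s) K) C :=
    (faithfulSMul_iff_algebraMap_injective _ _).mpr hg
  have : Algebra.IsIntegral (MvPolynomial (Fin s) K) C := inferInstance
  -- After Noether normalisation, q cuts out a hypersurface in affine space that contains the image
  -- of h = 0.
  obtain ⟨q, hq, hq0⟩ : ∃ q : MvPolynomial (Fin s) K, h ∣ g q ∧ q ≠ 0 := by
    have := Ideal.comap_ne_bot_of_integral_mem hh (Ideal.mem_span_singleton_self h)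
      (Algebra.IsIntegral.isIntegral (R := MvPolynomial (Fin s) K) h)
    obtain ⟨q, hq, hq0⟩ := Submodule.exists_mem_ne_zero_of_ne_bot this
    exact ⟨q, Ideal.mem_span_singleton.mp hq, hq0⟩
  let y : Fin s → K := fun i => ζ (g (MvPolynomial.X i))
  have hy : ∀ f, MvPolynomial.aeval y f = ζ (g f) := fun f => by
    have : MvPolynomial.aeval y = ζ.comp g := by ext i; simp [y]
    rw [this]; rfl
  have hyq : MvPolynomial.aeval y q = 0 := by
    obtain ⟨c, hc⟩ := hq
    rw [hy, hc, map_mul, hζ, zero_mul]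
  obtain ⟨y', hy'⟩ : ∃ y', MvPolynomial.eval y' q ≠ 0 := by
    by_contra! h0
    exact hq0 (MvPolynomial.funext fun x => by simpa using h0 x)
  obtain ⟨i, hi⟩ : ∃ i, y' i ≠ y i := by
    by_contra! h0
    rw [funext h0] at hy'
    exact hy' hyq
  -- Restriction to the line through y (parameter 0) and y' (parameter 1), which is not contained in
  -- q = 0.
  let ρ : MvPolynomial (Fin s) K →ₐ[K] K[X] :=
    MvPolynomial.aeval fun i => Polynomial.C (y i) + Polynomial.C (y' i - y i) * Polynomial.X
  have hρ0 : ∀ f, Polynomial.eval 0 (ρ f) = MvPolynomial.aeval y f := fun f => by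
    have : (Polynomial.aeval (0 : K)).comp ρ = MvPolynomial.aeval y := by ext i; simp [ρ]
    rw [← this]; simp [Polynomial.coe_aeval_eq_eval]
  have hρ1 : ∀ f, Polynomial.eval 1 (ρ f) = MvPolynomial.aeval y' f := fun f => by
    have : (Polynomial.aeval (1 : K)).comp ρ = MvPolynomial.aeval y' := by ext i; simp [ρ]
    rw [← this]; simp [Polynomial.coe_aeval_eq_eval]
  have hρ : Function.Surjective ρ := by
    have hsub : y' i - y i ≠ 0 := sub_ne_zero.mpr hi
    have hX : ρ (MvPolynomial.C (y' i - y i)⁻¹ * (MvPolynomial.X i - MvPolynomial.C (y i))) =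
        Polynomial.X := by
      simp only [ρ, map_mul, map_sub, MvPolynomial.aeval_X, MvPolynomial.aeval_C,
        Polynomial.algebraMap_eq]
      rw [← map_sub, add_sub_cancel_left, ← mul_assoc, ← Polynomial.C_mul, inv_mul_cancel₀ hsub]
      simp
    intro f
    refine ⟨Polynomial.aeval (MvPolynomial.C (y' i - y i)⁻¹ *
      (MvPolynomial.X i - MvPolynomial.C (y i))) f, ?_⟩
    rw [← Polynomial.aeval_algHom_apply, hX, Polynomial.aeval_X_left_apply]
  have hP : (RingHom.ker ρ).IsPrime := RingHom.ker_isPrime ρ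
  have hm : (RingHom.ker ζ).IsPrime := RingHom.ker_isPrime ζ
  have hP' : ((RingHom.ker ζ).under (MvPolynomial (Fin s) K)).IsPrime := Ideal.IsPrime.under _ _
  -- Going down lifts the line to a curve in Spec C through the given point; this curve is finite
  -- over the line and is not contained in h = 0.
  obtain ⟨Q, hQm, hQ, hQP⟩ := Ideal.exists_ideal_le_liesOver_of_le (p := RingHom.ker ρ)
    (q := (RingHom.ker ζ).under (MvPolynomial (Fin s) K)) (RingHom.ker ζ) (by
      intro f hf
      change ζ (g f) = 0
      rw [← hy, ← hρ0, (RingHom.mem_ker).mp hf, Polynomial.eval_zero])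
  have hQg : ∀ f, g f ∈ Q ↔ ρ f = 0 := fun f => by
    rw [← RingHom.mem_ker, hQP.over]; rfl
  have hhQ : h ∉ Q := fun h0 => by
    have h1 : g q ∈ Q := Q.mem_of_dvd hq h0
    rw [hQg] at h1
    have h2 := hρ1 q
    rw [h1, Polynomial.eval_zero] at h2
    exact hy' h2.symm
  let τ : K[X] →ₐ[K] C ⧸ Q :=
    AlgHom.liftOfSurjective ρ hρ ((Ideal.Quotient.mkₐ K Q).comp g) (by
      intro f hf
      exact Ideal.Quotient.eq_zero_iff_mem.mpr ((hQg f).mpr hf))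
  have hτ : ∀ f, τ (ρ f) = Ideal.Quotient.mkₐ K Q (g f) := fun f =>
    AlgHom.liftOfSurjective_apply _ _ _ _ _
  have hτinj : Function.Injective τ := by
    rw [injective_iff_map_eq_zero]
    intro f hf
    obtain ⟨f, rfl⟩ := hρ f
    rw [hτ] at hf
    exact (hQg f).mp (Ideal.Quotient.eq_zero_iff_mem.mp hf)
  have hτfin : τ.Finite := by
    have h1 : ((Ideal.Quotient.mkₐ K Q).comp g).Finite :=
      AlgHom.Finite.comp (AlgHom.Finite.of_surjective _ (Ideal.Quotient.mkₐ_surjective K Q)) hgfin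
    have h2 : τ.comp ρ = (Ideal.Quotient.mkₐ K Q).comp g := AlgHom.ext hτ
    rw [← h2] at h1
    exact AlgHom.Finite.of_comp_finite h1
  obtain ⟨γ, hγ, hγ'⟩ := exists_branch τ hτinj hτfin
    (Ideal.Quotient.liftₐ Q ζ fun a ha => hQm ha)
  refine ⟨γ.comp (Ideal.Quotient.mkₐ K Q), fun h0 => hhQ ?_, fun x => hγ' _⟩
  have h1 : γ (Ideal.Quotient.mkₐ K Q h) = 0 := h0
  rw [map_eq_zero_iff γ hγ] at h1
  exact Ideal.Quotient.eq_zero_iff_mem.mp h1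

/-- Geometric points of a general fibre of a dominant morphism of finite presentation. -/
theorem exists_forall_exists_lift (C A : Type u) [CommRing C] [IsDomain C] [CommRing A]
    [IsDomain A] [Algebra C A] [Algebra.FinitePresentation C A]
    (hinj : Function.Injective (algebraMap C A)) :
    ∃ h : C, h ≠ 0 ∧ ∀ (L : Type u) [Field L] [IsAlgClosed L] (f : C →+* L), f h ≠ 0 →
      ∃ g : A →+* L, ∀ x, g (algebraMap C A x) = f x := by
  have hc := PrimeSpectrum.isConstructible_range_comap
    (RingHom.finitePresentation_algebraMap.mpr ‹Algebra.FinitePresentation C A›)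
  obtain ⟨S, hS⟩ := PrimeSpectrum.exists_constructibleSetData_iff.mpr hc
  have hbot : (⊥ : PrimeSpectrum C) ∈ Set.range (PrimeSpectrum.comap (algebraMap C A)) := by
    refine ⟨⊥, ?_⟩
    ext x
    simp [map_eq_zero_iff _ hinj]
  rw [← hS] at hbot
  obtain ⟨B, hBS, hB⟩ : ∃ B ∈ S, (⊥ : PrimeSpectrum C) ∈ B.toSet := by
    simpa [PrimeSpectrum.ConstructibleSetData.toSet] using hbot
  -- By Chevalley the image is constructible. A locally closed piece containing the generic point
  -- has no closed conditions, hence is a basic open set.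
  have hg : ∀ i, B.g i = 0 := fun i => by
    have := hB.1 (Set.mem_range_self i)
    simpa using this
  have hf : B.f ≠ 0 := fun h0 => hB.2 (by simp [h0])
  refine ⟨B.f, hf, fun L _ _ f hfL => ?_⟩
  let P : PrimeSpectrum C := ⟨RingHom.ker f, RingHom.ker_isPrime f⟩
  obtain ⟨Q, hQ⟩ : P ∈ Set.range (PrimeSpectrum.comap (algebraMap C A)) := by
    rw [← hS]
    refine Set.mem_biUnion hBS ⟨?_, fun h0 => hfL ?_⟩
    · rintro _ ⟨i, rfl⟩
      simp [hg i]
    · simpa [P] using h0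
  let : Algebra C L := f.toAlgebra
  have hQP : ∀ x, algebraMap C A x ∈ Q.asIdeal ↔ f x = 0 := fun x => by
    rw [← RingHom.mem_ker]
    change x ∈ (PrimeSpectrum.comap (algebraMap C A) Q).asIdeal ↔ _
    rw [hQ]
  -- The geometric fibre is nonempty: it maps to a tensor product of two fields over the residue
  -- field of ker f. The Nullstellensatz then supplies an L-point.
  have hnt : Nontrivial (L ⊗[C] A) := by
    have hP : (RingHom.ker f).IsPrime := RingHom.ker_isPrime f
    let k := (RingHom.ker f).ResidueField
    let e₁ : k →ₐ[C] L := Ideal.ResidueField.liftₐ (RingHom.ker f) (Algebra.ofId C L)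
      (fun x hx => hx) (fun x hx => isUnit_iff_ne_zero.mpr fun h0 => hx h0)
    let e₂ : k →ₐ[C] Q.asIdeal.ResidueField := 
      Ideal.ResidueField.mapₐ (RingHom.ker f) Q.asIdeal (Algebra.ofId C A)
        (Ideal.ext fun x => (hQP x).symm)
    let : Algebra k L := e₁.toRingHom.toAlgebra
    let : Algebra k Q.asIdeal.ResidueField := e₂.toRingHom.toAlgebra
    have : IsScalarTower C k L := IsScalarTower.of_algebraMap_eq fun a => (e₁.commutes a).symm
    have : IsScalarTower C k Q.asIdeal.ResidueField :=
      IsScalarTower.of_algebraMap_eq fun a => (e₂.commutes a).symm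
    let F : L ⊗[C] A →ₐ[C] L ⊗[k] Q.asIdeal.ResidueField :=
      Algebra.TensorProduct.lift ((Algebra.TensorProduct.includeLeft :
          L →ₐ[k] L ⊗[k] Q.asIdeal.ResidueField).restrictScalars C)
        (((Algebra.TensorProduct.includeRight :
          Q.asIdeal.ResidueField →ₐ[k] L ⊗[k] Q.asIdeal.ResidueField).restrictScalars C).comp
          (IsScalarTower.toAlgHom C A Q.asIdeal.ResidueField)) (fun _ _ => Commute.all _ _)
    exact RingHom.domain_nontrivial F.toRingHom
  obtain ⟨m, hm⟩ := Ideal.exists_maximal (L ⊗[C] A)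
  let : Field ((L ⊗[C] A) ⧸ m) := Ideal.Quotient.field m
  have : Module.Finite L ((L ⊗[C] A) ⧸ m) := finite_of_finite_type_of_isJacobsonRing _ _
  have hbij : Function.Bijective (algebraMap L ((L ⊗[C] A) ⧸ m)) :=
    IsAlgClosed.algebraMap_bijective_of_isIntegral
  let e : L ≃ₐ[L] ((L ⊗[C] A) ⧸ m) := AlgEquiv.ofBijective (Algebra.ofId _ _) hbij
  let G : L ⊗[C] A →ₐ[L] L := e.symm.toAlgHom.comp (Ideal.Quotient.mkₐ L m)
  refine ⟨G.toRingHom.comp Algebra.TensorProduct.includeRight.toRingHom, fun x => ?_⟩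
  have : (1 : L) ⊗ₜ[C] algebraMap C A x = algebraMap L (L ⊗[C] A) (f x) := by
    refine ((Algebra.TensorProduct.includeRight : A →ₐ[C] L ⊗[C] A).commutes x).trans ?_
    rw [IsScalarTower.algebraMap_apply C L (L ⊗[C] A)]
    rfl
  change G ((1 : L) ⊗ₜ[C] algebraMap C A x) = _
  rw [this, AlgHom.commutes]
  rfl

open PowerSeries in
/-- Curve selection: a point in the Zariski closure of the image of a polynomial map is the centre
of an arc whose generic point lies in the image. -/
theorem exists_arc_of_mem_closure_image {ι N : Type} {K : Type u} [Field K] [IsAlgClosed K] [CharZero K]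
    [Finite ι] [Finite N] (σ : ι → MvPolynomial N K) (z : ι → K)
    (hz : ∀ g : MvPolynomial ι K, MvPolynomial.aeval σ g = 0 → MvPolynomial.aeval z g = 0) :
    ∃ Z : ι → K⟦X⟧, (∀ i, constantCoeff (Z i) = z i) ∧
      ∀ (L : Type u) [Field L] [IsAlgClosed L] [Algebra K⟦X⟧ L] [Algebra K L]
        [IsScalarTower K K⟦X⟧ L] [FaithfulSMul K⟦X⟧ L],
        ∃ w : N → L, ∀ i, MvPolynomial.aeval w (σ i) = algebraMap K⟦X⟧ L (Z i) := by
  let Φ : MvPolynomial ι K →ₐ[K] MvPolynomial N K := MvPolynomial.aeval σ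
  -- The coordinate ring of the closure of the image; `hz` says exactly that z is a point of it.
  let C := Φ.range
  have : Algebra.FiniteType K C :=
    Algebra.FiniteType.of_surjective Φ.rangeRestrict Φ.rangeRestrict_surjective
  have : IsNoetherianRing C := Algebra.FiniteType.isNoetherianRing K C
  have : Algebra.FiniteType C (MvPolynomial N K) := Algebra.FiniteType.of_restrictScalars_finiteType K _ _
  have : Algebra.FinitePresentation C (MvPolynomial N K) :=
    Algebra.FinitePresentation.of_finiteType.mp this
  obtain ⟨h, hh, hlift⟩ := exists_forall_exists_lift C (MvPolynomial N K) Subtype.val_injective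
  let ζ : C →ₐ[K] K := AlgHom.liftOfSurjective Φ.rangeRestrict Φ.rangeRestrict_surjective
    (MvPolynomial.aeval z) fun g hg => hz g (congrArg Subtype.val hg)
  have hζ : ∀ g, ζ (Φ.rangeRestrict g) = MvPolynomial.aeval z g := fun g =>
    AlgHom.liftOfSurjective_apply _ _ _ _ _
  obtain ⟨γ, hγ, hγ'⟩ := exists_arc ζ h hh
  refine ⟨fun i => γ (Φ.rangeRestrict (MvPolynomial.X i)), fun i => ?_, ?_⟩
  · rw [hγ', hζ, MvPolynomial.aeval_X]
  · intro L _ _ _ _ _ _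
    have hinj : Function.Injective (algebraMap K⟦X⟧ L) := FaithfulSMul.algebraMap_injective _ _
    obtain ⟨G, hG⟩ := hlift L ((algebraMap K⟦X⟧ L).comp γ.toRingHom)
      (fun h0 => hγ ((map_eq_zero_iff _ hinj).mp h0))
    let G' : MvPolynomial N K →ₐ[K] L :=
      { G with
        commutes' := fun a => by
          have := hG (algebraMap K C a)
          change G (algebraMap K _ a) = algebraMap K⟦X⟧ L (γ (algebraMap K C a)) at this
          rw [AlgHom.commutes, ← IsScalarTower.algebraMap_apply] at this
          exact this }
    refine ⟨fun j => G' (MvPolynomial.X j), fun i => ?_⟩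
    have h1 : MvPolynomial.aeval (fun j => G' (MvPolynomial.X j)) = G' := by
      ext j; simp
    rw [h1]
    have h2 := hG (Φ.rangeRestrict (MvPolynomial.X i))
    have h3 : algebraMap C (MvPolynomial N K) (Φ.rangeRestrict (MvPolynomial.X i)) = σ i :=
      MvPolynomial.aeval_X _ _
    rw [h3] at h2
    exact h2

end Arc

/-! ### Equations of an image closure under field extension -/

section BaseChange

/-- Expanding the coefficients of `g` in an F-basis of K writes it as a K-combination of equations
over F, each of which vanishes on the image by linear independence. -/
theorem aeval_eq_zero_of_baseChange {ι N F K : Type*} [Field F] [Field K] [Algebra F K]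
    (σ : ι → MvPolynomial N F) (z : ι → K)
    (h : ∀ g : MvPolynomial ι F, MvPolynomial.aeval σ g = 0 → MvPolynomial.aeval z g = 0)
    (g : MvPolynomial ι K)
    (hg : MvPolynomial.aeval (fun i => MvPolynomial.map (algebraMap F K) (σ i)) g = 0) :
    MvPolynomial.aeval z g = 0 := by
  classical
  let b := Module.Basis.ofVectorSpace F K
  let T := g.support.biUnion fun e => (b.repr (g.coeff e)).support
  let G := fun j => ∑ e ∈ g.support, MvPolynomial.monomial e (b.repr (g.coeff e) j)
  have hG : ∀ j e, (G j).coeff e = b.repr (g.coeff e) j := fun j e => by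
    simp only [G, MvPolynomial.coeff_sum, MvPolynomial.coeff_monomial, Finset.sum_ite_eq']
    split_ifs with he
    · rfl
    · rw [MvPolynomial.notMem_support_iff.mp he, map_zero, Finsupp.zero_apply]
  have hsum : g = ∑ j ∈ T, b j • MvPolynomial.map (algebraMap F K) (G j) := by
    ext e
    simp only [MvPolynomial.coeff_sum, MvPolynomial.coeff_smul, MvPolynomial.coeff_map, hG]
    conv_lhs => rw [← b.linearCombination_repr (g.coeff e), Finsupp.linearCombination_apply]
    rw [Finsupp.sum_of_support_subset (s := T)]
    · exact Finset.sum_congr rfl fun j _ => by rw [Algebra.smul_def, smul_eq_mul, mul_comm]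
    · by_cases he : e ∈ g.support
      · exact Finset.subset_biUnion_of_mem (fun e => (b.repr (g.coeff e)).support) he
      · rw [MvPolynomial.notMem_support_iff.mp he, map_zero]; simp
    · simp
  have hmap : ∀ j, MvPolynomial.aeval (fun i => MvPolynomial.map (algebraMap F K) (σ i))
      (MvPolynomial.map (algebraMap F K) (G j)) =
        MvPolynomial.map (algebraMap F K) (MvPolynomial.aeval σ (G j)) := fun j => by
    rw [MvPolynomial.aeval_map_algebraMap]
    induction G j using MvPolynomial.induction_on with
    | C a => simp [MvPolynomial.algebraMap_eq, MvPolynomial.algebraMap_apply]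
    | add p q hp hq => simp [hp, hq]
    | mul_X p i hp => simp [hp]
  have hzero : ∀ j ∈ T, MvPolynomial.aeval σ (G j) = 0 := fun j hj => by
    ext e
    rw [hsum, map_sum] at hg
    simp only [map_smul, hmap] at hg
    have h1 := congrArg (MvPolynomial.coeff e) hg
    simp only [MvPolynomial.coeff_sum, MvPolynomial.coeff_smul, MvPolynomial.coeff_map,
      MvPolynomial.coeff_zero] at h1
    have h2 := linearIndependent_iff'.mp b.linearIndependent T
      (fun j => (MvPolynomial.aeval σ (G j)).coeff e) (by
        rw [← h1]
        exact Finset.sum_congr rfl fun j _ => by rw [Algebra.smul_def, smul_eq_mul, mul_comm])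
    exact h2 j hj
  rw [hsum, map_sum]
  refine Finset.sum_eq_zero fun j hj => ?_
  rw [map_smul, MvPolynomial.aeval_map_algebraMap, h _ (hzero j hj), smul_zero]

end BaseChange

/-! ### Rank and border rank in coordinates -/

section Tensor

variable {F : Type*} [Field F] {m k : ℕ}

theorem coords_tprod (v : Fin k → Fin m → F) (p : Fin k → Fin m) :
    coords F m k (PiTensorProduct.tprod F v) p = ∏ a, v a (p a) := by
  simp [coords, Basis.piTensorProduct_repr_tprod_apply]

theorem smul_tprod_mem_simpleTensors (hk : 1 ≤ k) (c : F) (v : Fin k → Fin m → F) :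
    ∃ v', c • PiTensorProduct.tprod F v = PiTensorProduct.tprod F v' := by
  let a₀ : Fin k := ⟨0, hk⟩
  refine ⟨fun a => (if a = a₀ then c else 1) • v a, ?_⟩
  rw [MultilinearMap.map_smul_univ, Finset.prod_ite_eq' Finset.univ a₀ fun _ => c,
    if_pos (Finset.mem_univ a₀)]

theorem tensorRank_sum_tprod_le {J : Type*} [Fintype J] (u : J → Fin k → Fin m → F) :
    tensorRank (∑ x, PiTensorProduct.tprod F (u x)) ≤ Fintype.card J :=
  Nat.sInf_le ⟨fun i => PiTensorProduct.tprod F (u ((Fintype.equivFin J).symm i)),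
    fun _ => ⟨_, rfl⟩, ((Fintype.equivFin J).symm.sum_comp fun x => PiTensorProduct.tprod F (u x)).symm⟩

theorem exists_eq_sum_tprod (hk : 1 ≤ k) (T : Ten F m k) :
    ∃ u : (Fin k → Fin m) → Fin k → Fin m → F, T = ∑ x, PiTensorProduct.tprod F (u x) := by
  have h : ∀ x : Fin k → Fin m, ∃ u, coords F m k T x •
      PiTensorProduct.tprod F (fun a => Pi.basisFun F (Fin m) (x a)) = PiTensorProduct.tprod F u :=
    fun x => smul_tprod_mem_simpleTensors hk _ _
  choose u hu using h
  refine ⟨u, ?_⟩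
  rw [← Finset.sum_congr rfl fun x _ => hu x]
  have := (Basis.piTensorProduct fun _ : Fin k => Pi.basisFun F (Fin m)).sum_equivFun T
  conv_lhs => rw [← this]
  refine Finset.sum_congr rfl fun x _ => ?_
  rw [Basis.piTensorProduct_apply]
  rfl

/-- Shorter decompositions are padded with the zero tensor, which is simple because k ≥ 1. -/
theorem tensorRank_le_iff (hk : 1 ≤ k) (T : Ten F m k) (r : ℕ) :
    tensorRank T ≤ r ↔ ∃ u : Fin r → Fin k → Fin m → F, T = ∑ x, PiTensorProduct.tprod F (u x) := by
  constructor
  · intro h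
    obtain ⟨u, hu⟩ := exists_eq_sum_tprod hk T
    have hne : {r : ℕ | ∃ s : Fin r → Ten F m k, (∀ i, s i ∈ simpleTensors F m k) ∧
        T = ∑ i, s i}.Nonempty :=
      ⟨_, fun i => PiTensorProduct.tprod F (u ((Fintype.equivFin _).symm i)), fun i => ⟨_, rfl⟩,
        hu.trans ((Fintype.equivFin _).symm.sum_comp fun x => PiTensorProduct.tprod F (u x)).symm⟩
    obtain ⟨s, hs, hT⟩ : ∃ s : Fin (tensorRank T) → Ten F m k,
        (∀ i, s i ∈ simpleTensors F m k) ∧ T = ∑ i, s i := Nat.sInf_mem hne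
    choose v hv using hs
    obtain ⟨e, rfl⟩ := Nat.exists_eq_add_of_le h
    refine ⟨Fin.append v fun _ => 0, ?_⟩
    rw [Fin.sum_univ_add]
    have h0 : PiTensorProduct.tprod F (0 : Fin k → Fin m → F) = 0 :=
      (PiTensorProduct.tprod F).map_coord_zero ⟨0, hk⟩ rfl
    simp only [Fin.append_left, Fin.append_right, h0, Finset.sum_const_zero, add_zero]
    exact hT.trans (Finset.sum_congr rfl fun i _ => (hv i).symm)
  · rintro ⟨u, rfl⟩
    simpa using tensorRank_sum_tprod_le u

theorem mem_zariskiClosure_iff (A : Set (Ten F m k)) (T : Ten F m k) :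
    T ∈ zariskiClosure A ↔ ∀ g : MvPolynomial (Fin k → Fin m) F,
      (∀ T' ∈ A, MvPolynomial.aeval (coords F m k T') g = 0) →
        MvPolynomial.aeval (coords F m k T) g = 0 := by
  simp [zariskiClosure, MvPolynomial.mem_zeroLocus_iff, MvPolynomial.mem_vanishingIdeal_iff]

variable (F m k) in
/-- The coordinates of the generic tensor of rank `|J|`. -/
noncomputable def genericTensor (J : Type*) [Fintype J] (p : Fin k → Fin m) :
    MvPolynomial (J × Fin k × Fin m) F :=
  ∑ x, ∏ a, MvPolynomial.X (x, a, p a)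

theorem aeval_genericTensor {R : Type*} [CommRing R] [Algebra F R] {J : Type*} [Fintype J]
    (w : J × Fin k × Fin m → R) (p : Fin k → Fin m) :
    MvPolynomial.aeval w (genericTensor F m k J p) = ∑ x, ∏ a, w (x, a, p a) := by
  simp [genericTensor]

theorem aeval_aeval_genericTensor {R : Type*} [CommRing R] [Algebra F R] {J : Type*} [Fintype J]
    (u : J → Fin k → Fin m → R) (g : MvPolynomial (Fin k → Fin m) F) :
    MvPolynomial.aeval (fun y : J × Fin k × Fin m => u y.1 y.2.1 y.2.2)
      (MvPolynomial.aeval (genericTensor F m k J) g) =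
    MvPolynomial.aeval (fun p => ∑ x, ∏ a, u x a (p a)) g := by
  rw [MvPolynomial.comp_aeval_apply]
  simp only [aeval_genericTensor]

theorem coords_sum_tprod {J : Type*} [Fintype J] (u : J → Fin k → Fin m → F) :
    coords F m k (∑ x, PiTensorProduct.tprod F (u x)) = fun p => ∑ x, ∏ a, u x a (p a) := by
  ext p
  rw [map_sum, Finset.sum_apply]
  simp only [coords_tprod]

/-- Over an infinite field, a polynomial vanishing on all tensors of rank at most |J| vanishes
identically on the generic one. -/
theorem borderRank_le_card [Infinite F] {J : Type*} [Fintype J] (T : Ten F m k)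
    (h : ∀ g : MvPolynomial (Fin k → Fin m) F, MvPolynomial.aeval (genericTensor F m k J) g = 0 →
      MvPolynomial.aeval (coords F m k T) g = 0) :
    borderRank T ≤ Fintype.card J := by
  refine Nat.sInf_le ((mem_zariskiClosure_iff _ _).mpr fun g hg => h g ?_)
  refine MvPolynomial.funext fun w => ?_
  have := hg (∑ x, PiTensorProduct.tprod F fun a i => w (x, a, i))
    (tensorRank_sum_tprod_le (J := J) fun x a i => w (x, a, i))
  rw [coords_sum_tprod, ← aeval_aeval_genericTensor (fun x a i => w (x, a, i))] at this
  rw [map_zero]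
  exact this

theorem aeval_coords_eq_zero (hk : 1 ≤ k) {r : ℕ} {T : Ten F m k} (hT : borderRank T ≤ r)
    (g : MvPolynomial (Fin k → Fin m) F)
    (hg : MvPolynomial.aeval (genericTensor F m k (Fin r)) g = 0) :
    MvPolynomial.aeval (coords F m k T) g = 0 := by
  have hne : {r : ℕ | T ∈ zariskiClosure {T' : Ten F m k | tensorRank T' ≤ r}}.Nonempty :=
    ⟨tensorRank T, (mem_zariskiClosure_iff _ _).mpr fun g hg => hg T (le_refl (tensorRank T))⟩
  refine (mem_zariskiClosure_iff _ _).mp (Nat.sInf_mem hne) g fun T' hT' => ?_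
  obtain ⟨u, rfl⟩ := (tensorRank_le_iff hk T' r).mp (le_trans hT' hT)
  rw [coords_sum_tprod, ← aeval_aeval_genericTensor, hg, map_zero]

theorem borderRank_le_pow [Infinite F] (hk : 1 ≤ k) (T : Ten F m k) : borderRank T ≤ m ^ k := by
  obtain ⟨u, hu⟩ := exists_eq_sum_tprod hk T
  have := borderRank_le_card (J := Fin k → Fin m) T fun g hg => by
    rw [hu, coords_sum_tprod, ← aeval_aeval_genericTensor, hg, map_zero]
  simpa using this

theorem eq_zero_of_borderRank_eq_zero (hk : 1 ≤ k) {T : Ten F m k} (hT : borderRank T = 0) :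
    T = 0 := by
  rw [← (coords F m k).map_eq_zero_iff]
  ext p
  simpa using aeval_coords_eq_zero hk hT.le (MvPolynomial.X p) (by simp [genericTensor])

end Tensor

/-! ### From powers of linear forms to all forms -/

open scoped PowerSeries

universe u

theorem exists_monomial_eq_prod {R : Type*} [CommSemiring R] {n d : ℕ} (e : Fin n →₀ ℕ)
    (he : e.degree = d) :
    ∃ w : Fin d → Fin n, MvPolynomial.monomial e (1 : R) = ∏ j, MvPolynomial.X (w j) := by
  induction d generalizing e with
  | zero =>
    refine ⟨Fin.elim0, ?_⟩
    rw [(Finsupp.degree_eq_zero_iff e).mp he]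
    simp
  | succ d ih =>
    obtain ⟨i, hi⟩ : ∃ i, e i ≠ 0 := by
      by_contra! h
      rw [show e = 0 from Finsupp.ext h] at he
      simp at he
    have hle : Finsupp.single i 1 ≤ e := by
      rw [Finsupp.single_le_iff]; omega
    have hadd : Finsupp.single i 1 + (e - Finsupp.single i 1) = e := add_tsub_cancel_of_le hle
    obtain ⟨w, hw⟩ := ih (e - Finsupp.single i 1) (by
      rw [← hadd, map_add, Finsupp.degree_single] at he
      omega)
    refine ⟨Fin.cons i w, ?_⟩
    rw [Fin.prod_univ_succ]
    simp only [Fin.cons_zero, Fin.cons_succ]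
    rw [← hw, MvPolynomial.X, MvPolynomial.monomial_mul, hadd, one_mul]

theorem exists_eq_sum_words {F : Type*} [Field F] {n d : ℕ} (f : MvPolynomial (Fin n) F)
    (hf : f.IsHomogeneous d) :
    ∃ c : (Fin d → Fin n) → F, f = ∑ w, c w • ∏ j, MvPolynomial.X (w j) := by
  suffices h : f ∈ Submodule.span F
      (Set.range fun w : Fin d → Fin n => ∏ j, (MvPolynomial.X (w j) : MvPolynomial (Fin n) F)) by
    obtain ⟨c, hc⟩ := (Submodule.mem_span_range_iff_exists_fun F).mp h
    exact ⟨c, hc.symm⟩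
  rw [f.as_sum]
  refine Submodule.sum_mem _ fun e he => ?_
  have hd : e.degree = d := by
    by_contra h
    exact MvPolynomial.mem_support_iff.mp he (hf.coeff_eq_zero h)
  obtain ⟨w, hw⟩ := exists_monomial_eq_prod (R := F) e hd
  rw [← mul_one (f.coeff e), ← smul_eq_mul, ← MvPolynomial.smul_monomial, hw]
  exact Submodule.smul_mem _ _ (Submodule.subset_span ⟨w, rfl⟩)

/-- The coordinates of `φ`, extended by zero to all polynomials. -/
noncomputable def coordinate {F : Type*} [Field F] {n d m k : ℕ} (φ : Poly F n d →ₗ[F] Ten F m k)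
    (p : Fin k → Fin m) : MvPolynomial (Fin n) F →ₗ[F] F :=
  LinearMap.proj p ∘ₗ (coords F m k).toLinearMap ∘ₗ φ ∘ₗ
    (MvPolynomial.homogeneousComponent d).codRestrict (Poly F n d)
      (MvPolynomial.homogeneousComponent_mem d)

theorem coordinate_apply {F : Type*} [Field F] {n d m k : ℕ} (φ : Poly F n d →ₗ[F] Ten F m k)
    (p : Fin k → Fin m) (f : Poly F n d) :
    coordinate φ p f = coords F m k (φ f) p := by
  have : (MvPolynomial.homogeneousComponent d).codRestrict (Poly F n d)
      (MvPolynomial.homogeneousComponent_mem d) (f : MvPolynomial (Fin n) F) = f := by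
    ext1
    rw [LinearMap.codRestrict_apply, MvPolynomial.homogeneousComponent_of_mem f.2, if_pos rfl]
  simp only [coordinate, LinearMap.comp_apply, this]
  rfl

/-- If the tensors `φ (l ^ d)` have border rank at most `r`, then so has the generic one. -/
theorem aeval_genericPower_eq_zero {F K : Type*} [Field F] [Infinite F] [Field K] [Algebra F K]
    {n d m k r : ℕ} (hk : 1 ≤ k) (φ : Poly F n d →ₗ[F] Ten F m k)
    (hr : ∀ s ∈ powersOfLinearForms F n d, borderRank (φ s) ≤ r)
    [Algebra (MvPolynomial (Fin n) F) K] [IsScalarTower F (MvPolynomial (Fin n) F) K]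
    (g : MvPolynomial (Fin k → Fin m) F)
    (hg : MvPolynomial.aeval (genericTensor F m k (Fin r)) g = 0) :
    MvPolynomial.aeval (fun p => algebraMap (MvPolynomial (Fin n) F) K
      (genericPower (coordinate φ p) d 1)) g = 0 := by
  have h0 : MvPolynomial.aeval (fun p => genericPower (coordinate φ p) d 1) g = 0 := by
    refine MvPolynomial.funext fun a => ?_
    let l : MvPolynomial (Fin n) F := ∑ i, MvPolynomial.C (a i) * MvPolynomial.X i
    have hl : l ∈ Poly F n 1 := Submodule.sum_mem _ fun i _ => by
      rw [← MvPolynomial.smul_eq_C_mul]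
      exact Submodule.smul_mem _ _ (MvPolynomial.isHomogeneous_X F i)
    have hld : l ^ d ∈ Poly F n d := by
      have := MvPolynomial.IsHomogeneous.pow hl d
      rwa [one_mul] at this
    have h1 := aeval_coords_eq_zero hk (hr ⟨l ^ d, hld⟩ ⟨l, hl, rfl⟩) g hg
    have h2 : ∀ p, MvPolynomial.aeval a (genericPower (coordinate φ p) d 1) =
        coords F m k (φ ⟨l ^ d, hld⟩) p := fun p => by
      rw [← coordinate_apply]
      refine (eval_genericPower _ _ _ a).trans ?_
      rw [mul_one]
    rw [map_zero]
    change MvPolynomial.aeval a _ = 0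
    rw [MvPolynomial.comp_aeval_apply]
    simp only [h2]
    exact h1
  have := MvPolynomial.comp_aeval_apply (fun p => genericPower (coordinate φ p) d 1)
    (IsScalarTower.toAlgHom F (MvPolynomial (Fin n) F) K) g
  rw [h0, map_zero] at this
  exact this.symm

-- Differentiate an arc of generic rank at most r centred at the generic power tensor, then
-- specialise at X = 0.
open PowerSeries in
theorem borderRank_le {F : Type u} [Field F] [CharZero F] {n d m k r : ℕ} (hk : 1 ≤ k)
    (hn : d = 0 ∨ 1 ≤ n) (φ : Poly F n d →ₗ[F] Ten F m k)
    (hr : ∀ s ∈ powersOfLinearForms F n d, borderRank (φ s) ≤ r) (f : Poly F n d) :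
    borderRank (φ f) ≤ r * k ^ d * n ^ ((k - 1) * d / k) := by
  let A := MvPolynomial (Fin n) F
  let K := AlgebraicClosure (FractionRing A)
  have : CharZero K := charZero_of_injective_algebraMap (algebraMap F K).injective
  let z : (Fin k → Fin m) → K := fun p => algebraMap A K (genericPower (coordinate φ p) d 1)
  have hz : ∀ g : MvPolynomial (Fin k → Fin m) K,
      MvPolynomial.aeval (genericTensor K m k (Fin r)) g = 0 → MvPolynomial.aeval z g = 0 :=
    fun g hg => by
      refine aeval_eq_zero_of_baseChange (genericTensor F m k (Fin r)) z
        (fun g hg => aeval_genericPower_eq_zero hk φ hr g hg) g ?_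
      have : (fun p => MvPolynomial.map (algebraMap F K) (genericTensor F m k (Fin r) p)) =
          genericTensor K m k (Fin r) := by
        ext1 p; simp [genericTensor]
      rw [this, hg]
  obtain ⟨Z, hZ, hlift⟩ := exists_arc_of_mem_closure_image (genericTensor K m k (Fin r)) z hz
  let L := AlgebraicClosure (FractionRing K⟦X⟧)
  have hinjL : Function.Injective (algebraMap K⟦X⟧ L) := by
    rw [IsScalarTower.algebraMap_eq K⟦X⟧ (FractionRing K⟦X⟧) L]
    exact (algebraMap (FractionRing K⟦X⟧) L).injective.comp (IsFractionRing.injective _ _)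
  have : FaithfulSMul K⟦X⟧ L := (faithfulSMul_iff_algebraMap_injective _ _).mpr hinjL
  have : CharZero K⟦X⟧ := charZero_of_injective_algebraMap (algebraMap K K⟦X⟧).injective
  obtain ⟨w, hw⟩ := hlift L
  choose DK hDK using fun i : Fin n =>
    exists_derivation_extends (B := F) A K (MvPolynomial.pderiv i)
  choose DS hDS using fun i => exists_derivation_powerSeries (DK i)
  choose DL hDL using fun i => exists_derivation_extends K⟦X⟧ L (DS i)
  obtain ⟨c, hc⟩ := exists_eq_sum_words (f : MvPolynomial (Fin n) F) f.2
  obtain ⟨J, _, u, hJ, hu⟩ := exists_decomposition_sum_iterOp DL hk hn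
    (fun w => algebraMap F L (c w / (d.factorial : F))) (fun j a i => w (j, a, i))
  refine le_trans (borderRank_le_card (J := J) (φ f) fun g hg => ?_) hJ
  -- The arc f(∂)/d! applied to Z: over L it has the decomposition `u`, and its constant term is
  -- φ(f).
  let Y : (Fin k → Fin m) → K⟦X⟧ := fun p =>
    ∑ w, algebraMap F K⟦X⟧ (c w / (d.factorial : F)) *
      iterOp (fun i => DS i) d w (fun _ => true) (Z p)
  have hYL : ∀ p, algebraMap K⟦X⟧ L (Y p) = ∑ x, ∏ a, u x a (p a) := fun p => by
    rw [← hu, map_sum]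
    refine Finset.sum_congr rfl fun w' _ => ?_
    rw [map_mul, ← IsScalarTower.algebraMap_apply, map_iterOp _ fun i x => (hDL i x).symm, ← hw,
      aeval_genericTensor]
  have hY0 : ∀ p, constantCoeff (Y p) = algebraMap F K (coords F m k (φ f) p) := fun p => by
    rw [← coordinate_apply, hc, map_sum, map_sum, map_sum]
    refine Finset.sum_congr rfl fun w' _ => ?_
    have h1 : constantCoeff (algebraMap F K⟦X⟧ (c w' / (d.factorial : F))) =
        algebraMap F K (c w' / (d.factorial : F)) := by
      rw [PowerSeries.algebraMap_apply, constantCoeff_C]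
    have h2 := iterOp_pderiv_genericPower (coordinate φ p) d 0 w' 1
    rw [zero_add, Nat.descFactorial_self, mul_one, genericPower] at h2
    have h3 : algebraMap A K ((d.factorial : A) *
        MvPolynomial.C (coordinate φ p (∏ j, MvPolynomial.X (w' j)))) =
        algebraMap F K ((d.factorial : F) * coordinate φ p (∏ j, MvPolynomial.X (w' j))) := by
      rw [IsScalarTower.algebraMap_apply F A K, map_mul (algebraMap F A), map_natCast]
      rfl
    have hd : (d.factorial : F) ≠ 0 := Nat.cast_ne_zero.mpr d.factorial_ne_zero
    rw [map_mul, h1, map_iterOp (D' := fun i => DK i) constantCoeff hDS, hZ,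
      ← map_iterOp (D := fun i => MvPolynomial.pderiv i) (algebraMap A K) fun i x => (hDK i x).symm,
      h2, h3, ← map_mul, map_smul, smul_eq_mul, ← mul_assoc, div_mul_cancel₀ _ hd]
  have hgY : MvPolynomial.aeval Y g = 0 := by
    apply hinjL
    rw [map_zero]
    refine (MvPolynomial.comp_aeval_apply Y (IsScalarTower.toAlgHom F K⟦X⟧ L) g).trans ?_
    simp only [IsScalarTower.coe_toAlgHom', hYL]
    rw [← aeval_aeval_genericTensor, hg, map_zero]
  apply (algebraMap F K).injective
  rw [map_zero]
  refine (MvPolynomial.comp_aeval_apply _ (Algebra.ofId F K) g).trans ?_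
  let κ : K⟦X⟧ →ₐ[F] K :=
    { (constantCoeff : K⟦X⟧ →+* K) with
      commutes' := fun a => by
        change constantCoeff (algebraMap F K⟦X⟧ a) = _
        rw [PowerSeries.algebraMap_apply, constantCoeff_C] }
  have h4 : MvPolynomial.aeval (fun p => κ (Y p)) g = 0 := by
    rw [← MvPolynomial.comp_aeval_apply, hgY, map_zero]
  rw [← h4]
  congr 2
  ext1 p
  exact (hY0 p).symm

end BorderPotency

open BorderPotency in
theorem theorem6p10 (d k : ℕ) (hk : 1 ≤ k) :
    ∃ B : ℕ, ∀ (F : Type*) [Field F] [IsAlgClosed F] [CharZero F] (n m : ℕ)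
      (φ : BorderPotency.Poly F n d →ₗ[F] BorderPotency.Ten F m k),
      BddAbove (Set.range fun f => BorderPotency.borderRank (φ f)) ∧
      (φ ≠ 0 →
        0 < BorderPotency.maxBorderRank φ (BorderPotency.powersOfLinearForms F n d)) ∧
      BorderPotency.borderPotency φ ≤ (B : ℝ) * (n : ℝ) ^ ((k - 1) * d / k) := by
  -- k^d counts the ways to distribute d derivatives over k factors.
  refine ⟨k ^ d, fun F _ _ _ n m φ => ?_⟩
  have hbdd : ∀ A : Set (Poly F n d), BddAbove ((fun f => borderRank (φ f)) '' A) := fun A =>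
    ⟨m ^ k, by rintro _ ⟨f, -, rfl⟩; exact borderRank_le_pow hk _⟩
  set r := maxBorderRank φ (powersOfLinearForms F n d) with hr
  have hmain : ∀ f, borderRank (φ f) ≤ r * k ^ d * n ^ ((k - 1) * d / k) := fun f => by
    -- In the remaining case n = 0 < d the space P(0,d) is zero.
    by_cases hn : d = 0 ∨ 1 ≤ n
    · exact borderRank_le hk hn φ (fun s hs => le_csSup (hbdd _) ⟨s, hs, rfl⟩) f
    · obtain ⟨hd, hn⟩ := not_or.mp hn
      obtain rfl : n = 0 := by omega
      obtain ⟨c, hc⟩ := exists_eq_sum_words (f : MvPolynomial (Fin 0) F) f.2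
      have : IsEmpty (Fin d → Fin 0) := ⟨fun w => (w ⟨0, by omega⟩).elim0⟩
      have hf : f = 0 := by
        ext1
        rw [hc, Finset.univ_eq_empty, Finset.sum_empty]; rfl
      have h0 : borderRank (0 : Ten F m k) ≤ Fintype.card Empty :=
        borderRank_le_card _ fun g hg => by
          have := aeval_aeval_genericTensor (F := F) (R := F) (m := m) (k := k)
            (J := Empty) (fun x => x.elim) g
          rw [hg, map_zero] at this
          simp only [Finset.univ_eq_empty, Finset.sum_empty] at this
          rw [map_zero]
          exact this.symm
      rw [hf, map_zero]
      exact le_trans h0 (by simp)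
  refine ⟨?_, fun hφ => ?_, ?_⟩
  · simpa [Set.image_univ] using hbdd Set.univ
  · rw [Nat.pos_iff_ne_zero]
    intro h0
    -- If r = 0, the main bound forces border rank 0 on all of P(n,d), hence φ = 0.
    refine hφ (LinearMap.ext fun f => eq_zero_of_borderRank_eq_zero hk ?_)
    have := hmain f
    rw [h0] at this
    simpa using this
  · have h1 : maxBorderRank φ Set.univ ≤ r * k ^ d * n ^ ((k - 1) * d / k) :=
      csSup_le ⟨_, 0, Set.mem_univ _, rfl⟩ (by rintro _ ⟨f, -, rfl⟩; exact hmain f)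
    have h2 : (maxBorderRank φ Set.univ : ℝ) ≤ (r : ℝ) * (k : ℝ) ^ d * (n : ℝ) ^ ((k - 1) * d / k) := by
      exact_mod_cast h1
    -- This also covers r = 0, where the quotient is 0 by convention.
    refine div_le_of_le_mul₀ (Nat.cast_nonneg _) (by positivity) (h2.trans_eq ?_)
    push_cast
    ring
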